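/- Let $G$ be a non-solvable group acting on a tree $T$ (an oriented graph, whose orientation $G$ preserves) such that the topological realization of the quotient graph $G\backslash T$ is homeomorphic to a circle. Assume that (i) every vertex stabilizer is a free abelian group of finite rank; (ii) for every edge $e$ of $T$, the stabilizer $G_e$ is a direct factor of the stabilizer of each of the two end points of $e$; (iii) for all $x,y,z\in G$, if $xy=yx$ and $zxz^{-1}=y$, then $x=y$. Then there is a surjective homomorphism from $G$ onto the free group $\mathbb{F}_2$ of rank $2$. -/

import Mathlib

/-- An oriented graph with vertex set `V` and edge set `E`; loops and multiple edges are allowed. -/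
structure OrientedGraph (V E : Type*) where
  /-- the initial vertex of an edge -/
  src : E → V
  /-- the terminal vertex of an edge -/
  tgt : E → V

namespace OrientedGraph

/-- The unordered pair of end points of an edge. -/
def ends {V E : Type*} (Γ : OrientedGraph V E) (e : E) : Sym2 V := s(Γ.src e, Γ.tgt e)

/-- An oriented graph is a tree if it has no loops and no multiple edges (in either orientation)
and its underlying simple graph is a tree, that is, connected (so non-empty) without cycles. -/
structure IsTree {V E : Type*} (Γ : OrientedGraph V E) : Prop where
  no_loops : ∀ e : E, Γ.src e ≠ Γ.tgt e
  no_multiple_edges : Function.Injective Γ.ends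
  isTree : (SimpleGraph.fromEdgeSet (Set.range Γ.ends)).IsTree

/-- The actions of `G` on vertices and on edges form an action on the oriented graph `Γ`: they
commute with the adjacency functions. -/
structure IsAction {V E : Type*} (Γ : OrientedGraph V E)
    (G : Type*) [Group G] [MulAction G V] [MulAction G E] : Prop where
  src_smul : ∀ (g : G) (e : E), Γ.src (g • e) = g • Γ.src e
  tgt_smul : ∀ (g : G) (e : E), Γ.tgt (g • e) = g • Γ.tgt e

/-- The quotient graph `G \ Γ`: its vertices and edges are the `G`-orbits of vertices and edges. -/
def quotient {V E : Type*} (Γ : OrientedGraph V E)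
    (G : Type*) [Group G] [MulAction G V] [MulAction G E] (h : Γ.IsAction G) :
    OrientedGraph (MulAction.orbitRel.Quotient G V) (MulAction.orbitRel.Quotient G E) where
  src := Quotient.map' Γ.src (by
    rintro _ b ⟨g, rfl⟩
    exact ⟨g, (h.src_smul g b).symm⟩)
  tgt := Quotient.map' Γ.tgt (by
    rintro _ b ⟨g, rfl⟩
    exact ⟨g, (h.tgt_smul g b).symm⟩)

/-- The gluing relation of the topological realization: in the disjoint union of the set of
vertices and of one copy of `[0, 1]` for every edge, the end points `0` and `1` of the copy that
belongs to `e` are glued to the initial and to the terminal vertex of `e`. -/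
inductive Glue {V E : Type*} (Γ : OrientedGraph V E) :
    V ⊕ (Σ _ : E, unitInterval) → V ⊕ (Σ _ : E, unitInterval) → Prop
  | zero (e : E) : Glue Γ (Sum.inr ⟨e, 0⟩) (Sum.inl (Γ.src e))
  | one (e : E) : Glue Γ (Sum.inr ⟨e, 1⟩) (Sum.inl (Γ.tgt e))

/-- The topological realization of an oriented graph, a one-dimensional CW complex. -/
def Realization {V E : Type*} (Γ : OrientedGraph V E) : Type _ := Quot Γ.Glue

/-- The topology of the realization: the quotient topology of the topological disjoint union of
the discrete space of vertices and of the copies of `[0, 1]`. -/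
instance {V E : Type*} (Γ : OrientedGraph V E) : TopologicalSpace Γ.Realization :=
  letI : TopologicalSpace V := ⊥
  inferInstanceAs (TopologicalSpace (Quot Γ.Glue))

end OrientedGraph

/-- `A` is a free abelian group of finite rank. -/
def IsFreeAbelianOfFiniteRank (A : Type*) [Group A] : Prop :=
  ∃ n : ℕ, Nonempty (A ≃* Multiplicative (Fin n → ℤ))

/-- `H` is a direct factor of `K`: the subgroup `K` is the internal direct product of `H` and of
some subgroup `N`. -/
def Subgroup.IsDirectFactorOf {G : Type*} [Group G] (H K : Subgroup G) : Prop :=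
  ∃ N : Subgroup G, (∀ h ∈ H, ∀ n ∈ N, h * n = n * h) ∧ H ⊓ N = ⊥ ∧ H ⊔ N = K

/-! Cut the quotient circle in an edge `a` and lift the remaining arc to a path `v 0`, ..., `v m` in
the tree; then `a` joins `v m` to `t⁻¹ • v 0` for some `t`. As in Bass-Serre theory, `G` is
generated by the vertex stabilizers `A i` along the path and by `t`. Homomorphisms `F i : A i → ℤ`
that agree on the stabilizers of the path edges and vanish on those of `a` and `t • a` give a
homomorphism to the free group on `x`, `y`: it sends `g` in `A i` to `x ^ F i g`, and `t` to a power
of `x` times `y`. It is onto when the values of the `F i` generate `ℤ`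
(`CircuitLift.exists_surjective`).

Suppose that the stabilizer of `a` is a proper direct factor of `A m`. A nonzero rational function
on `A m` that vanishes on this factor is extended backwards along the path, by injectivity of `ℚ`,
to a family that vanishes on the stabilizer of `t • a`. The only obstruction lies in elements `g`
that fix `t • a` and the whole path. For these, `g` and `t⁻¹ * g * t` both lie in the abelian group
`A m`, so (iii) makes them equal; hence `g` fixes `a`, where the function is zero. Finite generation
allows rescaling to integral values that generate `ℤ`.

If no edge stabilizer is proper in an end point stabilizer, all vertex stabilizers coincide. Their
common value is normal and abelian, hence central by (iii), and together with `t` it generates `G`.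
So `G` is abelian, against non-solvability.

The circle enters only through two facts on cuts: no single edge of the quotient separates it, and
any two edges do. -/

/-! ### Sign changes of continuous functions on the circle -/

/-- A continuous real function on the circle with at most one zero has constant sign. -/
theorem Circle.pos_of_unique_zero {F : Circle → ℝ} (hF : Continuous F) (p : Circle)
    (hp : ∀ z, F z = 0 → z = p) {y z : Circle} (hy : 0 < F y) (hz : z ≠ p) (hyp : y ≠ p) :
    0 < F z := by
  by_contra hneg
  -- The angle is measured from the antipode of `p`, so the open interval from `-π` to `π`
  -- parametrizes the complement of `p`.
  set g : ℝ → ℝ := fun θ => F (p * Circle.exp Real.pi * Circle.exp θ) with hg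
  have hgc : Continuous g := by fun_prop
  have hpi : Circle.exp Real.pi * Circle.exp Real.pi = 1 := by
    rw [← Circle.exp_add, ← two_mul, Circle.exp_two_pi]
  have param : ∀ w : Circle, w ≠ p →
      ∃ θ ∈ Set.Ioo (-Real.pi) Real.pi, w = p * Circle.exp Real.pi * Circle.exp θ := by
    intro w hw
    set u : Circle := (p * Circle.exp Real.pi)⁻¹ * w with hu
    have hwu : w = p * Circle.exp Real.pi * Circle.exp (Complex.arg u) := by
      rw [Circle.exp_arg, hu, mul_inv_cancel_left]
    refine ⟨Complex.arg u, ⟨Complex.neg_pi_lt_arg _, lt_of_le_of_ne (Complex.arg_le_pi _) ?_⟩, hwu⟩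
    intro h
    rw [h, mul_assoc, hpi, mul_one] at hwu
    exact hw hwu
  obtain ⟨α, hα, rfl⟩ := param y hyp
  obtain ⟨β, hβ, rfl⟩ := param z hz
  obtain ⟨γ, hγ, h0⟩ := isPreconnected_Ioo.intermediate_value hβ hα hgc.continuousOn
    (Set.mem_Icc.2 ⟨not_lt.1 hneg, hy.le⟩ : (0 : ℝ) ∈ Set.Icc (g β) (g α))
  have h1 := hp _ h0
  -- A zero at `p` would force `π + γ = 2πn` with `-π < γ < π`, that is `0 < n < 1`.
  rw [mul_assoc, mul_eq_left, ← Circle.exp_add, Circle.exp_eq_one] at h1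
  obtain ⟨n, hn⟩ := h1
  have hπ := Real.pi_pos
  have h2 : (0 : ℝ) < n := by
    have := hγ.1
    by_contra hc
    nlinarith [not_lt.1 hc]
  have h3 : (n : ℝ) < 1 := by
    have := hγ.2
    by_contra hc
    nlinarith [not_lt.1 hc]
  have h4 : 0 < n := by exact_mod_cast h2
  have h5 : n < 1 := by exact_mod_cast h3
  omega

/-- Two points of the circle are the zero set of a continuous function that takes both signs. -/
theorem Circle.exists_continuous_zero_pair {a b : Circle} (hab : a ≠ b) :
    ∃ F : Circle → ℝ, Continuous F ∧ (∀ z, F z = 0 ↔ z = a ∨ z = b) ∧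
      (∃ z, 0 < F z) ∧ ∃ z, F z < 0 := by
  set A : ℂ := (a : ℂ)
  set B : ℂ := (b : ℂ)
  have hAB : A ≠ B := fun h => hab (Circle.ext h)
  have sq : ∀ z : Circle, (z : ℂ).re ^ 2 + (z : ℂ).im ^ 2 = 1 := by
    intro z
    have := Circle.normSq_coe z
    rw [Complex.normSq_apply] at this
    linarith
  have hA := sq a
  have hB := sq b
  -- An affine function whose zero set is the line through `A` and `B`; it takes opposite signs at
  -- the two unit normals of the chord.
  set F : Circle → ℝ := fun z => ((z : ℂ).re - A.re) * (B.im - A.im) -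
    ((z : ℂ).im - A.im) * (B.re - A.re) with hF
  have hpos : 0 < (B.re - A.re) ^ 2 + (B.im - A.im) ^ 2 := by
    rcases lt_or_eq_of_le (add_nonneg (sq_nonneg (B.re - A.re)) (sq_nonneg (B.im - A.im))) with
      h | h
    · exact h
    · exfalso
      apply hAB
      apply Complex.ext <;> nlinarith [sq_nonneg (B.re - A.re), sq_nonneg (B.im - A.im)]
  set r : ℝ := Real.sqrt ((B.re - A.re) ^ 2 + (B.im - A.im) ^ 2) with hr
  have hr0 : 0 < r := Real.sqrt_pos.2 hpos
  have hr2 : r ^ 2 = (B.re - A.re) ^ 2 + (B.im - A.im) ^ 2 := Real.sq_sqrt hpos.le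
  set x : ℝ := (B.re - A.re) / r with hx
  set y : ℝ := (B.im - A.im) / r with hy
  have hxr : x * r = B.re - A.re := div_mul_cancel₀ _ hr0.ne'
  have hyr : y * r = B.im - A.im := div_mul_cancel₀ _ hr0.ne'
  have hxy : x ^ 2 + y ^ 2 = 1 := by
    rw [hx, hy, div_pow, div_pow, ← add_div, ← hr2, div_self (pow_ne_zero 2 hr0.ne')]
  have hmem : (⟨y, -x⟩ : ℂ) ∈ Submonoid.unitSphere ℂ := by
    change (⟨y, -x⟩ : ℂ) ∈ Metric.sphere (0 : ℂ) 1
    rw [mem_sphere_zero_iff_norm, ← sq_eq_sq₀ (norm_nonneg _) zero_le_one, ← Complex.normSq_eq_norm_sq,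
      Complex.normSq_apply]
    simp only
    linarith
  -- the component of `A` along the normal of the chord is less than one in absolute value
  have hcr : (A.re * y - A.im * x) ^ 2 < 1 := by
    have h1 : (A.re * y - A.im * x) ^ 2 + (A.re * x + A.im * y) ^ 2 = 1 := by
      linear_combination (A.re ^ 2 + A.im ^ 2) * hxy + hA
    -- Both `A` and `B = A + r(x, y)` have norm one, so the component of `A` along the chord is
    -- `-r/2`, which is nonzero.
    have h2 : 2 * (A.re * x + A.im * y) * r + r ^ 2 = 0 := by
      rw [hr2]
      linear_combination 2 * A.re * hxr + 2 * A.im * hyr + hB - hA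
    have h3 : A.re * x + A.im * y ≠ 0 := by
      intro h
      rw [h] at h2
      nlinarith
    have h4 : 0 < (A.re * x + A.im * y) ^ 2 := by positivity
    linarith
  have hlt := abs_lt.1 ((sq_lt_one_iff_abs_lt_one _).1 hcr)
  refine ⟨F, ?_, ?_, ⟨⟨⟨y, -x⟩, hmem⟩, ?_⟩, ⟨-⟨⟨y, -x⟩, hmem⟩, ?_⟩⟩
  · have h1 : Continuous fun z : Circle => (z : ℂ).re := Complex.continuous_re.comp continuous_subtype_val
    have h2 : Continuous fun z : Circle => (z : ℂ).im := Complex.continuous_im.comp continuous_subtype_val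
    fun_prop
  · intro z
    constructor
    · intro h
      have hz := sq z
      simp only [hF] at h
      set X := (z : ℂ).re
      set Y := (z : ℂ).im
      -- The parameter of `z` on the line `A + l(B - A)`; norm one leaves only `l = 0` and `l = 1`.
      set l : ℝ := ((X - A.re) * (B.re - A.re) + (Y - A.im) * (B.im - A.im)) / r ^ 2 with hl
      have hlr : l * r ^ 2 = (X - A.re) * (B.re - A.re) + (Y - A.im) * (B.im - A.im) :=
        div_mul_cancel₀ _ (pow_ne_zero 2 hr0.ne')
      have hX : X = A.re + l * (B.re - A.re) := by
        apply mul_right_cancel₀ (pow_ne_zero 2 hr0.ne')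
        linear_combination (-(B.re - A.re)) * hlr + (X - A.re) * hr2 + (B.im - A.im) * h
      have hY : Y = A.im + l * (B.im - A.im) := by
        apply mul_right_cancel₀ (pow_ne_zero 2 hr0.ne')
        linear_combination (-(B.im - A.im)) * hlr + (Y - A.im) * hr2 - (B.re - A.re) * h
      have hll : l * (l - 1) = 0 := by
        apply mul_right_cancel₀ (pow_ne_zero 2 hr0.ne')
        rw [hX, hY] at hz
        linear_combination (l * (l - 1)) * hr2 + hz - hA - l * (hB - hA)
      rcases mul_eq_zero.1 hll with h0 | h1
      · left
        apply Circle.ext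
        apply Complex.ext
        · change X = A.re
          rw [hX, h0]; ring
        · change Y = A.im
          rw [hY, h0]; ring
      · right
        have h1 : l = 1 := by linarith
        apply Circle.ext
        apply Complex.ext
        · change X = B.re
          rw [hX, h1]; ring
        · change Y = B.im
          rw [hY, h1]; ring
    · rintro (rfl | rfl) <;> simp only [hF, A, B] <;> ring
  · have : F ⟨⟨y, -x⟩, hmem⟩ = r * (1 - (A.re * y - A.im * x)) := by
      change (y - A.re) * (B.im - A.im) - (-x - A.im) * (B.re - A.re) = _
      rw [← hxr, ← hyr]
      linear_combination r * hxy
    rw [this]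
    exact mul_pos hr0 (by linarith [hlt.2])
  · have : F (-⟨⟨y, -x⟩, hmem⟩) = - (r * (1 + (A.re * y - A.im * x))) := by
      change (-y - A.re) * (B.im - A.im) - (- -x - A.im) * (B.re - A.re) = _
      rw [← hxr, ← hyr]
      linear_combination (-r) * hxy
    rw [this]
    exact neg_neg_of_pos (mul_pos hr0 (by linarith [hlt.1]))

/-! ### Cuts in a graph whose realization is a circle -/

namespace OrientedGraph

variable {V E : Type*} (Γ : OrientedGraph V E)

/-- The point of the realization that belongs to a vertex. -/
def vertexPoint (v : V) : Γ.Realization := Quot.mk _ (Sum.inl v)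

/-- The point of the realization with coordinate `r` on the edge `e`. -/
def edgePoint (e : E) (r : unitInterval) : Γ.Realization := Quot.mk _ (Sum.inr ⟨e, r⟩)

theorem edgePoint_zero (e : E) : Γ.edgePoint e 0 = Γ.vertexPoint (Γ.src e) :=
  Quot.sound (Glue.zero e)

theorem edgePoint_one (e : E) : Γ.edgePoint e 1 = Γ.vertexPoint (Γ.tgt e) :=
  Quot.sound (Glue.one e)

theorem exists_eq_point (p : Γ.Realization) :
    (∃ v, p = Γ.vertexPoint v) ∨ ∃ e r, p = Γ.edgePoint e r := by
  induction p using Quot.ind with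
  | mk a =>
    rcases a with v | ⟨e, r⟩
    · exact Or.inl ⟨v, rfl⟩
    · exact Or.inr ⟨e, r, rfl⟩

theorem continuous_edgePoint (e : E) : Continuous (Γ.edgePoint e) := by
  let : TopologicalSpace V := ⊥
  have h : Continuous (fun r : unitInterval => (Sum.inr ⟨e, r⟩ : V ⊕ (Σ _ : E, unitInterval))) :=
    continuous_inr.comp continuous_sigmaMk
  exact continuous_quot_mk.comp h

/-- The function on the realization that interpolates linearly a function on the vertices. -/
def interpolate (φ : V → ℝ) : Γ.Realization → ℝ :=
  Quot.lift (Sum.elim φ fun x : Σ _ : E, unitInterval =>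
    (1 - (x.2 : ℝ)) * φ (Γ.src x.1) + (x.2 : ℝ) * φ (Γ.tgt x.1)) (by
      rintro _ _ (e | e) <;> simp)

theorem continuous_interpolate (φ : V → ℝ) : Continuous (Γ.interpolate φ) := by
  let : TopologicalSpace V := ⊥
  have : DiscreteTopology V := ⟨rfl⟩
  refine continuous_quot_lift _ ?_
  refine continuous_of_discreteTopology.sumElim ?_
  refine continuous_sigma fun e => ?_
  simp only
  fun_prop

theorem interpolate_vertexPoint (φ : V → ℝ) (v : V) :
    Γ.interpolate φ (Γ.vertexPoint v) = φ v := rfl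

theorem interpolate_edgePoint (φ : V → ℝ) (e : E) (r : unitInterval) :
    Γ.interpolate φ (Γ.edgePoint e r) = (1 - (r : ℝ)) * φ (Γ.src e) + (r : ℝ) * φ (Γ.tgt e) := rfl

/-- Gluing only involves the parameters `0` and `1`, so the property of being the interior point `s`
of `d` descends to the quotient. -/
theorem edgePoint_injective {e d : E} {r s : unitInterval} (hs : s ≠ 0) (hs' : s ≠ 1)
    (h : Γ.edgePoint e r = Γ.edgePoint d s) : e = d ∧ r = s := by
  let P : Γ.Realization → Prop :=
    Quot.lift (Sum.elim (fun _ => False) fun x : Σ _ : E, unitInterval => x.1 = d ∧ x.2 = s) (by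
      rintro _ _ (e | e)
      · simp [hs.symm]
      · simp [hs'.symm])
  have h1 : P (Γ.edgePoint d s) := ⟨rfl, rfl⟩
  rw [← h] at h1
  exact h1

theorem vertexPoint_ne_edgePoint {v : V} {d : E} {s : unitInterval} (hs : s ≠ 0) (hs' : s ≠ 1) :
    Γ.vertexPoint v ≠ Γ.edgePoint d s := by
  intro h
  let P : Γ.Realization → Prop :=
    Quot.lift (Sum.elim (fun _ => False) fun x : Σ _ : E, unitInterval => x.1 = d ∧ x.2 = s) (by
      rintro _ _ (e | e)
      · simp [hs.symm]
      · simp [hs'.symm])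
  have h1 : P (Γ.edgePoint d s) := ⟨rfl, rfl⟩
  rw [← h] at h1
  exact h1

/-- If the realization is a circle, then no edge separates its end points. -/
theorem src_iff_tgt_of_circle (h : Γ.Realization ≃ₜ Circle) (d : E) (s : V → Prop)
    (hs : ∀ e, e ≠ d → (s (Γ.src e) ↔ s (Γ.tgt e))) : s (Γ.src d) ↔ s (Γ.tgt d) := by
  classical
  by_contra hd
  -- If `d` separated its end points, the interpolation of these signs would vanish only at the
  -- midpoint of `d` and still take both signs.
  set φ : V → ℝ := fun v => if s v then 1 else -1 with hφ
  have hφ0 : ∀ v, φ v ≠ 0 := by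
    intro v
    by_cases hv : s v <;> simp [hφ, hv]
  have hdφ : φ (Γ.src d) + φ (Γ.tgt d) = 0 := by
    by_cases h1 : s (Γ.src d) <;> by_cases h2 : s (Γ.tgt d) <;> simp_all
  set c : unitInterval := ⟨1 / 2, by norm_num, by norm_num⟩ with hc
  have hc0 : c ≠ 0 := fun h => by simpa [hc] using congrArg Subtype.val h
  have hc1 : c ≠ 1 := fun h => by
    have := congrArg Subtype.val h
    norm_num [hc] at this
  have zero : ∀ z, (Γ.interpolate φ ∘ h.symm) z = 0 → z = h (Γ.edgePoint d c) := by
    intro z hz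
    rw [← h.symm_apply_eq]
    simp only [Function.comp_apply] at hz
    rcases Γ.exists_eq_point (h.symm z) with ⟨v, hv⟩ | ⟨e, r, hr⟩
    · rw [hv, interpolate_vertexPoint] at hz
      exact absurd hz (hφ0 v)
    · rw [hr, interpolate_edgePoint] at hz
      by_cases hed : e = d
      · subst hed
        rw [hr]
        congr 1
        apply Subtype.ext
        have h1 : (1 - 2 * (r : ℝ)) * φ (Γ.src e) = 0 := by linear_combination hz - r * hdφ
        have h2 := (mul_eq_zero.1 h1).resolve_right (hφ0 _)
        change (r : ℝ) = 1 / 2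
        linarith
      · have h1 : φ (Γ.src e) = φ (Γ.tgt e) := by simp only [hφ, hs e hed]
        rw [h1] at hz
        exact absurd (by linarith) (hφ0 (Γ.tgt e))
  have key : ∀ v w, s v → s w := by
    intro v w hv
    have h1 := Circle.pos_of_unique_zero
      ((Γ.continuous_interpolate φ).comp h.symm.continuous) _ zero
      (y := h (Γ.vertexPoint v)) (z := h (Γ.vertexPoint w))
      (by simp [interpolate_vertexPoint, hφ, hv])
      (fun he => Γ.vertexPoint_ne_edgePoint hc0 hc1 (h.injective he))
      (fun he => Γ.vertexPoint_ne_edgePoint hc0 hc1 (h.injective he))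
    by_contra hw
    simp only [Function.comp_apply, h.symm_apply_apply, interpolate_vertexPoint, hφ, hw,
      if_false] at h1
    linarith
  exact hd ⟨key _ _, key _ _⟩

/-- If the realization is a circle, then two edges together separate it. -/
theorem exists_separation_of_circle (h : Γ.Realization ≃ₜ Circle) {d d' : E} (hd : d ≠ d') :
    ∃ s : V → Prop, (∀ e, e ≠ d → e ≠ d' → (s (Γ.src e) ↔ s (Γ.tgt e))) ∧
      (∃ v, s v) ∧ ∃ v, ¬ s v := by
  set c : unitInterval := ⟨1 / 2, by norm_num, by norm_num⟩ with hc
  have hc0 : c ≠ 0 := fun h => by simpa [hc] using congrArg Subtype.val h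
  have hc1 : c ≠ 1 := fun h => by
    have := congrArg Subtype.val h
    norm_num [hc] at this
  -- `F` vanishes exactly at the midpoints of `d` and `d'`; the two sides of the cut are given by
  -- its sign at the vertices.
  obtain ⟨F, hF, hz, ⟨y, hy⟩, z, hz'⟩ := Circle.exists_continuous_zero_pair
    (a := h (Γ.edgePoint d c)) (b := h (Γ.edgePoint d' c))
    (fun he => hd (Γ.edgePoint_injective hc0 hc1 (h.injective he)).1)
  have hzero : ∀ e r, F (h (Γ.edgePoint e r)) = 0 → (e = d ∨ e = d') ∧ r = c := by
    intro e r h0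
    rcases (hz _).1 h0 with h1 | h1
    · exact ⟨Or.inl (Γ.edgePoint_injective hc0 hc1 (h.injective h1)).1,
        (Γ.edgePoint_injective hc0 hc1 (h.injective h1)).2⟩
    · exact ⟨Or.inr (Γ.edgePoint_injective hc0 hc1 (h.injective h1)).1,
        (Γ.edgePoint_injective hc0 hc1 (h.injective h1)).2⟩
  have hvne : ∀ v, F (h (Γ.vertexPoint v)) ≠ 0 := by
    intro v h0
    rcases (hz _).1 h0 with h1 | h1 <;>
      exact Γ.vertexPoint_ne_edgePoint hc0 hc1 (h.injective h1)
  have hcont : ∀ e, Continuous fun r => F (h (Γ.edgePoint e r)) := fun e =>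
    hF.comp (h.continuous.comp (Γ.continuous_edgePoint e))
  -- the sign is constant on segments without zero
  have hseg : ∀ e (r t : unitInterval), r ≤ t →
      (∀ u ∈ Set.Icc r t, F (h (Γ.edgePoint e u)) ≠ 0) →
      (0 < F (h (Γ.edgePoint e r)) ↔ 0 < F (h (Γ.edgePoint e t))) := by
    intro e r t hrt hne
    have hpre : IsPreconnected (Set.Icc r t) := isPreconnected_Icc
    have aux : ∀ p ∈ Set.Icc r t, ∀ q ∈ Set.Icc r t, 0 < F (h (Γ.edgePoint e p)) →
        0 < F (h (Γ.edgePoint e q)) := by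
      intro p hp q hq hpos
      by_contra hneg
      obtain ⟨u, hu, h0⟩ := hpre.intermediate_value hq hp (hcont e).continuousOn
        (Set.mem_Icc.2 ⟨not_lt.1 hneg, hpos.le⟩)
      exact hne u hu h0
    exact ⟨aux _ ⟨le_rfl, hrt⟩ _ ⟨hrt, le_rfl⟩, aux _ ⟨hrt, le_rfl⟩ _ ⟨le_rfl, hrt⟩⟩
  -- every sign that occurs occurs at a vertex
  have hvert : ∀ x, F x ≠ 0 → ∃ v, 0 < F (h (Γ.vertexPoint v)) ↔ 0 < F x := by
    intro x hx
    rcases Γ.exists_eq_point (h.symm x) with ⟨v, hv⟩ | ⟨e, r, hr⟩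
    · refine ⟨v, ?_⟩
      rw [← hv, h.apply_symm_apply]
    · have hxr : x = h (Γ.edgePoint e r) := by rw [← hr, h.apply_symm_apply]
      subst hxr
      -- A zero on `e` can only be at the midpoint, so the segment from `r` to the end point on the
      -- same side of `c` has none.
      rcases le_total r c with hrc | hrc
      · refine ⟨Γ.src e, ?_⟩
        rw [← edgePoint_zero]
        refine hseg e 0 r r.2.1 fun u hu h0 => hx ?_
        have h1 := (hzero e u h0).2
        have h2 : u = r := le_antisymm hu.2 (h1 ▸ hrc)
        rwa [← h2]
      · refine ⟨Γ.tgt e, ?_⟩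
        rw [← edgePoint_one]
        refine (hseg e r 1 r.2.2 fun u hu h0 => hx ?_).symm
        have h1 := (hzero e u h0).2
        have h2 : u = r := le_antisymm (h1 ▸ hrc) hu.1
        rwa [← h2]
  refine ⟨fun v => 0 < F (h (Γ.vertexPoint v)), fun e he he' => ?_, ?_, ?_⟩
  · simp only [← edgePoint_zero, ← edgePoint_one]
    refine hseg e 0 1 zero_le_one fun u _ h0 => ?_
    exact (hzero e u h0).1.elim he he'
  · obtain ⟨v, hv⟩ := hvert y hy.ne'
    exact ⟨v, hv.2 hy⟩
  · obtain ⟨v, hv⟩ := hvert z hz'.ne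
    exact ⟨v, fun h1 => (hv.1 h1).not_gt hz'⟩

/-- If the realization is a circle and any two vertices are connected, then there is an edge. -/
theorem nonempty_edge_of_circle (h : Γ.Realization ≃ₜ Circle)
    (hconn : IsEmpty E → Subsingleton V) : Nonempty E := by
  by_contra hE
  rw [not_nonempty_iff] at hE
  have := hconn hE
  have hsub : Subsingleton Γ.Realization := by
    refine ⟨fun p q => ?_⟩
    rcases Γ.exists_eq_point p with ⟨v, rfl⟩ | ⟨e, -⟩
    · rcases Γ.exists_eq_point q with ⟨w, rfl⟩ | ⟨e, -⟩
      · rw [Subsingleton.elim v w]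
      · exact hE.elim e
    · exact hE.elim e
  have h1 : h.symm (-1) = h.symm 1 := Subsingleton.elim _ _
  exact Circle.neg_ne_self 1 (h.symm.injective h1)

end OrientedGraph

/-! ### Potentials and cocycles on trees -/

namespace OrientedGraph

variable {V E : Type*} {T : OrientedGraph V E}

theorem IsTree.adj (hT : T.IsTree) (e : E) :
    (SimpleGraph.fromEdgeSet (Set.range T.ends)).Adj (T.src e) (T.tgt e) := by
  rw [SimpleGraph.fromEdgeSet_adj]
  exact ⟨⟨e, rfl⟩, hT.no_loops e⟩

/-- A property of vertices that passes along edges in both directions holds everywhere in a tree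
if it holds somewhere. -/
theorem IsTree.induction (hT : T.IsTree) (P : V → Prop)
    (hP : ∀ e, P (T.src e) ↔ P (T.tgt e)) {v : V} (hv : P v) (w : V) : P w := by
  obtain ⟨p⟩ := hT.isTree.connected.preconnected v w
  induction p with
  | nil => exact hv
  | cons hadj _ ih =>
    apply ih
    rw [SimpleGraph.fromEdgeSet_adj] at hadj
    obtain ⟨⟨e, he⟩, -⟩ := hadj
    rcases Sym2.eq_iff.1 he with ⟨h1, h2⟩ | ⟨h1, h2⟩
    · rw [← h2, ← hP, h1]
      exact hv
    · rw [← h1, hP, h2]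
      exact hv

/-- The product of edge weights along a walk. -/
def walkProd {H : Type*} [Group H] {Γ : SimpleGraph V} (ω : V → V → H) :
    {x y : V} → Γ.Walk x y → H
  | _, _, .nil => 1
  | x, _, .cons (v := z) _ p => walkProd ω p * ω x z

theorem walkProd_concat {H : Type*} [Group H] {Γ : SimpleGraph V} (ω : V → V → H)
    {x y z : V} (p : Γ.Walk x y) (h : Γ.Adj y z) :
    walkProd ω (p.concat h) = ω y z * walkProd ω p := by
  induction p with
  | nil => simp [SimpleGraph.Walk.concat, walkProd]
  | cons h' p ih => rw [SimpleGraph.Walk.concat_cons, walkProd, walkProd, ih, mul_assoc]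

/-- In a tree every labelling of the edges by group elements is the coboundary of a labelling of
the vertices. -/
theorem IsTree.exists_potential (hT : T.IsTree) {H : Type*} [Group H] (τ : E → H) (v₀ : V) :
    ∃ σ : V → H, σ v₀ = 1 ∧ ∀ e, σ (T.tgt e) = τ e * σ (T.src e) := by
  classical
  set Γ := SimpleGraph.fromEdgeSet (Set.range T.ends)
  -- Crossing an edge backwards contributes the inverse label; pairs that are not joined get the
  -- irrelevant value `1`.
  set ω : V → V → H := fun x y =>
    if h : ∃ e, T.src e = x ∧ T.tgt e = y then τ h.choose
    else if h : ∃ e, T.src e = y ∧ T.tgt e = x then (τ h.choose)⁻¹ else 1 with hω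
  have hω1 : ∀ e, ω (T.src e) (T.tgt e) = τ e := by
    intro e
    have h : ∃ d, T.src d = T.src e ∧ T.tgt d = T.tgt e := ⟨e, rfl, rfl⟩
    have h1 : h.choose = e :=
      hT.no_multiple_edges (by rw [ends, ends, h.choose_spec.1, h.choose_spec.2])
    simp only [hω]
    rw [dif_pos h, h1]
  have hω2 : ∀ e, ω (T.tgt e) (T.src e) = (τ e)⁻¹ := by
    intro e
    have h : ∃ d, T.src d = T.src e ∧ T.tgt d = T.tgt e := ⟨e, rfl, rfl⟩
    have h1 : h.choose = e :=
      hT.no_multiple_edges (by rw [ends, ends, h.choose_spec.1, h.choose_spec.2])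
    have h2 : ¬ ∃ d, T.src d = T.tgt e ∧ T.tgt d = T.src e := by
      rintro ⟨d, hd1, hd2⟩
      have hde : d = e := hT.no_multiple_edges (by rw [ends, ends, hd1, hd2, Sym2.eq_swap])
      rw [hde] at hd1
      exact hT.no_loops e hd1
    simp only [hω]
    rw [dif_neg h2, dif_pos h, h1]
  have hconn := hT.isTree.connected.preconnected
  have hac := hT.isTree.isAcyclic
  choose p hp using fun w => (hconn v₀ w).exists_isPath
  refine ⟨fun w => walkProd ω (p w), ?_, fun e => ?_⟩
  · have h : p v₀ = .nil := by
      have := (hac.subsingleton_path v₀ v₀).elim ⟨p v₀, hp v₀⟩ ⟨.nil, .nil⟩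
      exact congrArg Subtype.val this
    simp [h, walkProd]
  · have hadj := hT.adj e
    change walkProd ω (p (T.tgt e)) = τ e * walkProd ω (p (T.src e))
    -- In a tree, of the paths from `v₀` to two adjacent vertices, one extends the other by the
    -- joining edge.
    by_cases hs : T.src e ∈ (p (T.tgt e)).support
    · rw [hac.path_concat (hp _) (hp _) hadj hs, walkProd_concat, hω1]
    · have ht := hac.mem_support_of_ne_mem_support_of_adj_of_isPath (hp _) (hp _) hadj hs
      rw [hac.path_concat (hp _) (hp _) hadj.symm ht, walkProd_concat, hω2, mul_inv_cancel_left]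

variable {G : Type*} [Group G] [MulAction G V] [MulAction G E]

/-- A cocycle on the vertices of a tree with values in `H`, with compatible labels on
representatives of the edge orbits, defines a homomorphism to `H`. -/
theorem IsTree.exists_monoidHom_of_cocycle (hT : T.IsTree) (hG : T.IsAction G)
    {H : Type*} [Group H] (c : G → V → H) (hc : ∀ g h v, c (g * h) v = c g (h • v) * c h v)
    (R : Set E) (hR : ∀ e, ∃ r ∈ R, ∃ g : G, g • r = e)
    (hR' : ∀ r ∈ R, ∀ r' ∈ R, ∀ g : G, g • r = r' → r = r')
    (τ₀ : E → H)
    (hτ₀ : ∀ r ∈ R, ∀ s : G, s • r = r → c s (T.tgt r) * τ₀ r = τ₀ r * c s (T.src r))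
    (v₀ : V) :
    ∃ (σ : V → H) (φ : G →* H), σ v₀ = 1 ∧ (∀ r ∈ R, σ (T.tgt r) = τ₀ r * σ (T.src r)) ∧
      ∀ g v, φ g = (σ (g • v))⁻¹ * c g v * σ v := by
  choose r hrR γ hγ using hR
  have hc1 : ∀ v, c 1 v = 1 := fun v => by simpa using hc 1 1 v
  -- `c` makes `G` act on the trivial bundle with fibre `H` over the vertices. `τ` is the invariant
  -- transport along edges that extends `τ₀`; the hypothesis `hτ₀` makes it independent of the
  -- choice of `γ`.
  set τ : E → H := fun e =>
    c (γ e) (T.tgt (r e)) * τ₀ (r e) * (c (γ e) (T.src (r e)))⁻¹ with hτ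
  -- independence of the chosen element
  have key : ∀ d ∈ R, ∀ k : G, τ (k • d) = c k (T.tgt d) * τ₀ d * (c k (T.src d))⁻¹ := by
    intro d hd k
    have h1 : r (k • d) = d := by
      refine hR' _ (hrR _) _ hd (k⁻¹ * γ (k • d)) ?_
      rw [mul_smul, hγ, inv_smul_smul]
    simp only [hτ, h1]
    have h2 : (k⁻¹ * γ (k • d)) • d = d := by
      have := hγ (k • d)
      rw [h1] at this
      rw [mul_smul, this, inv_smul_smul]
    obtain ⟨s, h3⟩ : ∃ s, γ (k • d) = k * s := ⟨k⁻¹ * γ (k • d), by rw [mul_inv_cancel_left]⟩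
    rw [h3, inv_mul_cancel_left] at h2
    have h4 : s • T.tgt d = T.tgt d := by rw [← hG.tgt_smul, h2]
    have h5 : s • T.src d = T.src d := by rw [← hG.src_smul, h2]
    rw [h3, hc k s, hc k s, h4, h5, mul_inv_rev, mul_assoc _ _ (τ₀ d), hτ₀ d hd s h2]
    group
  have hequiv : ∀ (g : G) e, τ (g • e) = c g (T.tgt e) * τ e * (c g (T.src e))⁻¹ := by
    intro g e
    obtain ⟨d, hd, k, rfl⟩ : ∃ d ∈ R, ∃ k : G, k • d = e := ⟨r e, hrR e, γ e, hγ e⟩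
    rw [← mul_smul, key d hd, key d hd, hc, hc, hG.tgt_smul, hG.src_smul]
    group
  obtain ⟨σ, hσ0, hσ⟩ := hT.exists_potential τ v₀
  -- `σ` is a parallel section. By invariance of `τ`, its discrepancy from its translate by `g` does
  -- not change across an edge.
  have hindep : ∀ g v, (σ (g • v₀))⁻¹ * c g v₀ * σ v₀ = (σ (g • v))⁻¹ * c g v * σ v := by
    intro g v
    refine hT.induction
      (fun v => (σ (g • v₀))⁻¹ * c g v₀ * σ v₀ = (σ (g • v))⁻¹ * c g v * σ v) ?_ rfl v
    intro e
    have : (σ (g • T.tgt e))⁻¹ * c g (T.tgt e) * σ (T.tgt e) =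
        (σ (g • T.src e))⁻¹ * c g (T.src e) * σ (T.src e) := by
      rw [← hG.tgt_smul, ← hG.src_smul, hσ, hσ, hequiv]
      group
    rw [this]
  refine ⟨σ, MonoidHom.mk' (fun g => (σ (g • v₀))⁻¹ * c g v₀ * σ v₀) ?_, hσ0, ?_, ?_⟩
  · intro g h
    rw [hindep g (h • v₀), hc, mul_smul]
    group
  · intro d hd
    rw [hσ]
    have := key d hd 1
    rw [one_smul, hc1, hc1, one_mul, inv_one, mul_one] at this
    rw [this]
  · exact hindep

/-! ### Lifting the quotient circuit to the tree -/

/-- A path in `T` and an edge `a` that maps to the whole of a quotient circuit: the path joins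
`v 0` to `v m` through representatives of all vertex orbits, and `a` joins `v m` to a translate of
`v 0`. -/
structure CircuitLift (T : OrientedGraph V E) (G : Type*) [Group G] [MulAction G V]
    [MulAction G E] (a : E) where
  /-- the length of the path -/
  m : ℕ
  /-- the vertices of the path -/
  v : ℕ → V
  /-- the edges of the path -/
  e : ℕ → E
  /-- the element that closes the path up -/
  t : G
  ends_e : ∀ i < m, T.ends (e i) = s(v i, v (i + 1))
  ends_a : T.ends a = s(v m, t⁻¹ • v 0)
  vertex_cover : ∀ w, ∃ i ≤ m, ∃ g : G, g • v i = w
  vertex_inj : ∀ i ≤ m, ∀ j ≤ m, ∀ g : G, g • v i = v j → i = j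
  edge_cover : ∀ d, (∃ g : G, g • a = d) ∨ ∃ i < m, ∃ g : G, g • e i = d
  edge_ne : ∀ i < m, ∀ g : G, g • e i ≠ a

theorem IsTree.quotient_induction (hT : T.IsTree) (hG : T.IsAction G)
    (s : MulAction.orbitRel.Quotient G V → Prop)
    (hs : ∀ e, s ((T.quotient G hG).src e) ↔ s ((T.quotient G hG).tgt e))
    {x : MulAction.orbitRel.Quotient G V} (hx : s x) (y : MulAction.orbitRel.Quotient G V) :
    s y := by
  induction x using Quotient.inductionOn with
  | h x =>
    induction y using Quotient.inductionOn with
    | h y => exact hT.induction (fun v => s ⟦v⟧) (fun e => hs ⟦e⟧) hx y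

/-- If the quotient of a tree by a group is a circle, then each end point `p` of each edge `a` is
the last vertex of a lift of the circuit that closes up with `a`. -/
theorem exists_circuitLift (hT : T.IsTree) (hG : T.IsAction G)
    (hcircle : (T.quotient G hG).Realization ≃ₜ Circle) (a : E) (p q : V)
    (hpq : T.ends a = s(p, q)) :
    ∃ L : CircuitLift T G a, L.v L.m = p := by
  classical
  set Q := T.quotient G hG
  set π : V → MulAction.orbitRel.Quotient G V := fun w => ⟦w⟧ with hπ
  have hπeq : ∀ {w w' : V}, π w = π w' ↔ ∃ g : G, g • w' = w := fun {w w'} => by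
    simp only [hπ, Quotient.eq]
    exact MulAction.orbitRel_apply
  set ε : E → MulAction.orbitRel.Quotient G E := fun d => ⟦d⟧ with hε
  have hεeq : ∀ {d d' : E}, ε d = ε d' ↔ ∃ g : G, g • d' = d := fun {d d'} => by
    simp only [hε, Quotient.eq]
    exact MulAction.orbitRel_apply
  -- the quotient graph without the edge `a`
  set Δ : SimpleGraph (MulAction.orbitRel.Quotient G V) :=
    SimpleGraph.fromRel fun x y => ∃ d, ε d ≠ ε a ∧ π (T.src d) = x ∧ π (T.tgt d) = y with hΔ
  have hΔadj : ∀ x y, Δ.Adj x y ↔ x ≠ y ∧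
      ((∃ d, ε d ≠ ε a ∧ π (T.src d) = x ∧ π (T.tgt d) = y) ∨
        ∃ d, ε d ≠ ε a ∧ π (T.src d) = y ∧ π (T.tgt d) = x) := fun x y => by
    rw [hΔ, SimpleGraph.fromRel_adj]
  have hends : ∀ (s : MulAction.orbitRel.Quotient G V → Prop) (d : E) (x y : V),
      T.ends d = s(x, y) → ((s (π (T.src d)) ↔ s (π (T.tgt d))) ↔ (s (π x) ↔ s (π y))) := by
    intro s d x y hd
    rcases Sym2.eq_iff.1 hd with ⟨h1, h2⟩ | ⟨h1, h2⟩
    · rw [h1, h2]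
    · rw [h1, h2]
      exact Iff.comm
  -- Otherwise the set of vertices reachable from `π q` without `a` would be a cut by the single
  -- edge `a`.
  have hreach : Δ.Reachable (π q) (π p) := by
    have h1 : Δ.Reachable (π q) (π p) ↔ Δ.Reachable (π q) (π q) := by
      refine (hends (fun x => Δ.Reachable (π q) x) a p q hpq).1 ?_
      refine Q.src_iff_tgt_of_circle hcircle (ε a) (fun x => Δ.Reachable (π q) x) fun e he => ?_
      induction e using Quotient.inductionOn with
      | h d =>
        change Δ.Reachable (π q) (π (T.src d)) ↔ Δ.Reachable (π q) (π (T.tgt d))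
        by_cases hd : π (T.src d) = π (T.tgt d)
        · rw [hd]
        · have hadj : Δ.Adj (π (T.src d)) (π (T.tgt d)) := by
            rw [hΔadj]
            exact ⟨hd, Or.inl ⟨d, he, rfl, rfl⟩⟩
          exact ⟨fun h => h.trans hadj.reachable, fun h => h.trans hadj.symm.reachable⟩
    exact h1.2 (SimpleGraph.Reachable.refl _)
  obtain ⟨w, hw⟩ := hreach.exists_isPath
  have step : ∀ (i : ℕ) (u : V), ∃ (u' : V) (d : E), i < w.length → π u = w.getVert i →
      π u' = w.getVert (i + 1) ∧ T.ends d = s(u, u') ∧ ε d ≠ ε a := by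
    intro i u
    by_cases hi : i < w.length ∧ π u = w.getVert i
    · obtain ⟨hi, hu⟩ := hi
      have hadj := w.adj_getVert_succ hi
      rw [hΔadj] at hadj
      rcases hadj.2 with ⟨d, hd, h1, h2⟩ | ⟨d, hd, h1, h2⟩
      · obtain ⟨g, hg⟩ := hπeq.1 (hu.trans h1.symm)
        refine ⟨g • T.tgt d, g • d, fun _ _ => ⟨?_, ?_, ?_⟩⟩
        · rw [← h2, hπeq]
          exact ⟨g, rfl⟩
        · rw [ends, hG.src_smul, hG.tgt_smul, hg]
        · rwa [hεeq.2 ⟨g, rfl⟩]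
      · obtain ⟨g, hg⟩ := hπeq.1 (hu.trans h2.symm)
        refine ⟨g • T.src d, g • d, fun _ _ => ⟨?_, ?_, ?_⟩⟩
        · rw [← h1, hπeq]
          exact ⟨g, rfl⟩
        · rw [ends, hG.src_smul, hG.tgt_smul, hg, Sym2.eq_swap]
        · rwa [hεeq.2 ⟨g, rfl⟩]
    · exact ⟨u, a, fun h1 h2 => absurd ⟨h1, h2⟩ hi⟩
  choose nxt ed hstep using step
  -- The walk is lifted step by step from `q`; a translation by `g` then moves its last vertex to
  -- `p`, and `g` becomes the closing element.
  set v' : ℕ → V := fun i => Nat.rec q (fun i u => nxt i u) i with hv'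
  have hv'π : ∀ i ≤ w.length, π (v' i) = w.getVert i := by
    intro i
    induction i with
    | zero =>
      intro _
      rw [w.getVert_zero]
      rfl
    | succ i ih => exact fun hi => (hstep i (v' i) hi (ih (Nat.le_of_lt hi))).1
  obtain ⟨g, hg⟩ : ∃ g : G, g • v' w.length = p := by
    apply hπeq.1
    rw [hv'π _ le_rfl, w.getVert_length]
  set v : ℕ → V := fun i => g • v' i with hv
  set e : ℕ → E := fun i => g • ed i (v' i) with he
  have hvπ : ∀ i ≤ w.length, π (v i) = w.getVert i := fun i hi => by
    rw [← hv'π i hi, hπeq]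
    exact ⟨g, rfl⟩
  have hee : ∀ i < w.length, T.ends (e i) = s(v i, v (i + 1)) := by
    intro i hi
    have h1 := (hstep i (v' i) hi (hv'π i hi.le)).2.1
    rcases Sym2.eq_iff.1 h1 with ⟨h2, h3⟩ | ⟨h2, h3⟩
    · rw [ends, hG.src_smul, hG.tgt_smul, h2, h3]
    · rw [ends, hG.src_smul, hG.tgt_smul, h2, h3, Sym2.eq_swap]
  have hea : ∀ i < w.length, ε (e i) ≠ ε a := by
    intro i hi
    rw [hεeq.2 ⟨g, rfl⟩]
    exact (hstep i (v' i) hi (hv'π i hi.le)).2.2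
  -- Suppose that the orbit of `d` is missed. Then `d` and `a` cut the circle, but the lifted path
  -- avoids both and joins the end points of `a` in the quotient. So `d` alone would be a cut, which
  -- is impossible.
  have hcover : ∀ d, ε d = ε a ∨ ∃ i < w.length, ε d = ε (e i) := by
    intro d
    by_contra! hd
    obtain ⟨s, hs, ⟨x, hx⟩, y, hy⟩ := Q.exists_separation_of_circle hcircle (Ne.symm hd.1)
    have hpath : ∀ i ≤ w.length, s (π (v i)) ↔ s (π q) := by
      intro i
      induction i with
      | zero =>
        intro _
        rw [hvπ 0 (Nat.zero_le _), w.getVert_zero]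
      | succ i ih =>
        intro hi
        rw [← ih (Nat.le_of_lt hi)]
        exact ((hends s _ _ _ (hee i hi)).1
          (hs (ε (e i)) (hea i hi) (fun h => hd.2 i hi h.symm))).symm
    have hsa : s (Q.src (ε a)) ↔ s (Q.tgt (ε a)) := by
      refine (hends s a p q hpq).2 ?_
      rw [← hpath _ le_rfl, hvπ _ le_rfl, w.getVert_length]
    have hsd : ∀ e', e' ≠ ε d → (s (Q.src e') ↔ s (Q.tgt e')) := by
      intro e' he'
      by_cases h1 : e' = ε a
      · rw [h1]; exact hsa
      · exact hs e' h1 he'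
    refine hy (hT.quotient_induction hG s (fun e' => ?_) hx y)
    by_cases h1 : e' = ε d
    · rw [h1]
      exact Q.src_iff_tgt_of_circle hcircle (ε d) s hsd
    · exact hsd e' h1
  have hvcover : ∀ y, ∃ i ≤ w.length, y = π (v i) := by
    refine hT.quotient_induction hG _ (fun e' => ?_)
      (x := π q) ⟨0, Nat.zero_le _, by rw [hvπ 0 (Nat.zero_le _), w.getVert_zero]⟩
    induction e' using Quotient.inductionOn with
    | h d =>
      have hboth : ∀ d' x y, ε d = ε d' → T.ends d' = s(x, y) →
          (∃ i ≤ w.length, π x = π (v i)) → (∃ i ≤ w.length, π y = π (v i)) →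
          ((∃ i ≤ w.length, Q.src (ε d) = π (v i)) ↔ ∃ i ≤ w.length, Q.tgt (ε d) = π (v i)) := by
        intro d' x y hd' hxy hx hy
        rw [hd']
        exact (hends (fun z => ∃ i ≤ w.length, z = π (v i)) d' x y hxy).2
          ⟨fun _ => hy, fun _ => hx⟩
      rcases hcover d with h1 | ⟨i, hi, h1⟩
      · refine hboth a p q h1 hpq ⟨w.length, le_rfl, ?_⟩ ⟨0, Nat.zero_le _, ?_⟩
        · rw [hvπ _ le_rfl, w.getVert_length]
        · rw [hvπ _ (Nat.zero_le _), w.getVert_zero]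
      · exact hboth (e i) _ _ h1 (hee i hi) ⟨i, hi.le, rfl⟩ ⟨i + 1, hi, rfl⟩
  refine ⟨⟨w.length, v, e, g, hee, ?_, fun y => ?_, fun i hi j hj k hk => ?_, fun d => ?_,
    fun i hi k hk => ?_⟩, hg⟩
  · change T.ends a = s(g • v' w.length, g⁻¹ • g • q)
    rw [hg, inv_smul_smul, hpq]
  · obtain ⟨i, hi, h1⟩ := hvcover (π y)
    exact ⟨i, hi, hπeq.1 h1⟩
  · have h1 : π (v j) = π (v i) := hπeq.2 ⟨k, hk⟩
    rw [hvπ i hi, hvπ j hj] at h1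
    exact (hw.getVert_injOn hj hi h1).symm
  · rcases hcover d with h1 | ⟨i, hi, h1⟩
    · exact Or.inl (hεeq.1 h1)
    · exact Or.inr ⟨i, hi, hεeq.1 h1⟩
  · exact hea i hi (hεeq.2 ⟨k, hk⟩).symm

end OrientedGraph

/-! ### Extending additive functions with values in `ℚ` -/

/-- Homomorphisms to `ℚ` extend along homomorphisms of abelian groups. -/
theorem AddMonoidHom.exists_extension_rat {A B : Type*} [AddCommGroup A] [AddCommGroup B]
    (r : B →+ A) (f : B →+ ℚ) (h : r.ker ≤ f.ker) : ∃ F : A →+ ℚ, ∀ b, F (r b) = f b := by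
  -- `ℚ` is divisible, hence injective, and `B` modulo the kernel of `r` embeds into `A`.
  obtain ⟨F, hF⟩ := (Module.Baer.of_divisible ℚ).extension_property_addMonoidHom
    (QuotientAddGroup.kerLift r) (QuotientAddGroup.kerLift_injective r)
    (QuotientAddGroup.lift r.ker f h)
  exact ⟨F, fun b => DFunLike.congr_fun hF (b : B ⧸ r.ker)⟩

/-- A function on a group is additive on a subgroup. -/
def Subgroup.AdditiveOn {G M : Type*} [Group G] [Add M] (A : Subgroup G) (f : G → M) : Prop :=
  ∀ x ∈ A, ∀ y ∈ A, f (x * y) = f x + f y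

namespace Subgroup.AdditiveOn

variable {G M : Type*} [Group G] [AddCommGroup M]

theorem map_one {A : Subgroup G} {f : G → M} (hf : A.AdditiveOn f) : f 1 = 0 := by
  simpa using hf 1 A.one_mem 1 A.one_mem

theorem map_inv {A : Subgroup G} {f : G → M} (hf : A.AdditiveOn f) {x : G} (hx : x ∈ A) :
    f x⁻¹ = -f x := by
  have := hf x hx x⁻¹ (A.inv_mem hx)
  rw [mul_inv_cancel, hf.map_one] at this
  exact (neg_eq_of_add_eq_zero_right this.symm).symm

theorem map_conj {A : Subgroup G} {f : G → M} (hf : A.AdditiveOn f) {x y : G} (hx : x ∈ A)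
    (hy : y ∈ A) : f (y⁻¹ * x * y) = f x := by
  rw [hf _ (A.mul_mem (A.inv_mem hy) hx) _ hy, hf _ (A.inv_mem hy) _ hx, hf.map_inv hy]
  abel

theorem mono {A B : Subgroup G} (h : B ≤ A) {f : G → M} (hf : A.AdditiveOn f) :
    B.AdditiveOn f := fun x hx y hy => hf x (h hx) y (h hy)

/-- An additive function on a subgroup `B` of an abelian group `A` extends to `A`, with value zero
on a subgroup `U` if it is zero on `B ⊓ U`. -/
theorem exists_extension {A B U : Subgroup G} (hB : B ≤ A) (hU : U ≤ A)
    (hA : ∀ x ∈ A, ∀ y ∈ A, x * y = y * x) {f : G → ℚ} (hf : B.AdditiveOn f)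
    (hfU : ∀ x ∈ B, x ∈ U → f x = 0) :
    ∃ F : G → ℚ, A.AdditiveOn F ∧ (∀ x ∈ B, F x = f x) ∧ ∀ x ∈ U, F x = 0 := by
  classical
  let iA : CommGroup A := { (inferInstance : Group A) with
    mul_comm := fun x y => Subtype.ext (hA x x.2 y y.2) }
  let iB : CommGroup B := { (inferInstance : Group B) with
    mul_comm := fun x y => Subtype.ext (hA x (hB x.2) y (hB y.2)) }
  let W : AddSubgroup (Additive A) := Subgroup.toAddSubgroup (U.subgroupOf A)
  -- The kernel of `B → A / U` is `B ⊓ U`, so one extension along it both prolongs `f` and vanishes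
  -- on `U`.
  let r : Additive B →+ Additive A ⧸ W :=
    (QuotientAddGroup.mk' W).comp (MonoidHom.toAdditive (Subgroup.inclusion hB))
  let f' : Additive B →+ ℚ := AddMonoidHom.mk' (fun b => f (b.toMul : B)) fun b c =>
    hf _ b.toMul.2 _ c.toMul.2
  have hker : r.ker ≤ f'.ker := by
    intro b hb
    rw [AddMonoidHom.mem_ker] at hb ⊢
    have hbU : (b.toMul : G) ∈ U := (QuotientAddGroup.eq_zero_iff _).1 hb
    exact hfU _ b.toMul.2 hbU
  obtain ⟨F, hF⟩ := AddMonoidHom.exists_extension_rat r f' hker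
  refine ⟨fun x => if hx : x ∈ A then
    F (QuotientAddGroup.mk' W (Additive.ofMul (⟨x, hx⟩ : A))) else 0, ?_, ?_, ?_⟩
  · intro x hx y hy
    simp only [hx, hy, A.mul_mem hx hy, dif_pos]
    rw [← map_add, ← map_add]
    rfl
  · intro x hx
    simp only [hB hx, dif_pos]
    exact hF (Additive.ofMul (⟨x, hx⟩ : B))
  · intro x hx
    simp only [hU hx, dif_pos]
    have : QuotientAddGroup.mk' W (Additive.ofMul (⟨x, hU hx⟩ : A)) = 0 :=
      (QuotientAddGroup.eq_zero_iff _).2 hx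
    rw [this, map_zero]

/-- An abelian torsion-free group with a proper direct factor `C` has a nonzero additive function
that vanishes on `C`. -/
theorem exists_ne_zero {A C : Subgroup G} (hA : ∀ x ∈ A, ∀ y ∈ A, x * y = y * x)
    (htf : ∀ x ∈ A, ∀ n : ℤ, n ≠ 0 → x ^ n = 1 → x = 1)
    (hC : C.IsDirectFactorOf A) (hCA : C ≠ A) :
    ∃ F : G → ℚ, A.AdditiveOn F ∧ (∀ x ∈ C, F x = 0) ∧ ∃ x ∈ A, F x ≠ 0 := by
  classical
  obtain ⟨N, -, hCN, hsup⟩ := hC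
  have hN : N ≠ ⊥ := by
    rintro rfl
    exact hCA (by rw [← hsup, sup_bot_eq])
  obtain ⟨x, hxN, hx1⟩ := N.bot_or_exists_ne_one.resolve_left hN
  have hNA : N ≤ A := hsup ▸ le_sup_right
  have hinj : ∀ n k : ℤ, x ^ n = x ^ k → n = k := by
    intro n k h
    by_contra hnk
    refine hx1 (htf x (hNA hxN) (n - k) (sub_ne_zero.2 hnk) ?_)
    rw [zpow_sub, h, mul_inv_cancel]
  -- On the infinite cyclic group generated by `x` in the complement `N`, `f` reads off the
  -- exponent. This group meets `C` trivially, so `f` extends with value zero on `C`.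
  set f : G → ℚ := fun y => if h : ∃ n : ℤ, x ^ n = y then (h.choose : ℚ) else 0 with hf
  have hfx : ∀ n : ℤ, f (x ^ n) = n := by
    intro n
    have h : ∃ k : ℤ, x ^ k = x ^ n := ⟨n, rfl⟩
    simp only [hf]
    rw [dif_pos h, hinj _ _ h.choose_spec]
  obtain ⟨F, hFA, hFx, hFC⟩ := exists_extension (A := A) (B := Subgroup.zpowers x) (U := C) (f := f)
    (by rw [Subgroup.zpowers_le]; exact hNA hxN) (hsup ▸ le_sup_left) hA
    (by
      rintro _ ⟨n, rfl⟩ _ ⟨k, rfl⟩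
      simp only
      rw [← zpow_add, hfx, hfx, hfx, Int.cast_add])
    (by
      rintro _ ⟨n, rfl⟩ hn
      simp only at hn ⊢
      have h1 : x ^ n ∈ C ⊓ N := ⟨hn, N.zpow_mem hxN n⟩
      rw [hCN, Subgroup.mem_bot] at h1
      rw [h1, ← zpow_zero x, hfx, Int.cast_zero])
  refine ⟨F, hFA, hFC, x, hNA hxN, ?_⟩
  rw [hFx x (Subgroup.mem_zpowers x), ← zpow_one x, hfx]
  norm_num

end Subgroup.AdditiveOn

/-! ### Compatible families along a chain of abelian groups -/

namespace Subgroup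

variable {G : Type*} [Group G]

/-- The intersection of `B` with the first `i` subgroups of a sequence. -/
def infUpTo (B : Subgroup G) (C : ℕ → Subgroup G) : ℕ → Subgroup G
  | 0 => B
  | i + 1 => Subgroup.infUpTo B C i ⊓ C i

theorem infUpTo_le (B : Subgroup G) (C : ℕ → Subgroup G) (m : ℕ) :
    B.infUpTo C m ≤ B := by
  induction m with
  | zero => exact le_rfl
  | succ m ih => exact inf_le_left.trans ih

theorem infUpTo_le_of_chain {A C : ℕ → Subgroup G} {B : Subgroup G} (hB : B ≤ A 0)
    {m : ℕ} (hC : ∀ i < m, C i ≤ A (i + 1)) : B.infUpTo C m ≤ A m := by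
  cases m with
  | zero => exact hB
  | succ k => exact inf_le_right.trans (hC k (Nat.lt_succ_self k))

/-- Along a sequence of abelian groups in which neighbours `A i` and `A (i + 1)` share the subgroup
`C i`, an additive function on the last group that vanishes on the intersection of `B` with all
`C i` extends to a compatible family that vanishes on `B`. -/
theorem exists_compatible_family (A C : ℕ → Subgroup G) (B : Subgroup G) (hB : B ≤ A 0)
    (m : ℕ) (hA : ∀ i ≤ m, ∀ x ∈ A i, ∀ y ∈ A i, x * y = y * x)
    (hC : ∀ i < m, C i ≤ A i) (hC' : ∀ i < m, C i ≤ A (i + 1))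
    (F : G → ℚ) (hF : (A m).AdditiveOn F) (hFU : ∀ x ∈ B.infUpTo C m, F x = 0) :
    ∃ f : ℕ → G → ℚ, f m = F ∧ (∀ i ≤ m, (A i).AdditiveOn (f i)) ∧
      (∀ i < m, ∀ x ∈ C i, f i x = f (i + 1) x) ∧ ∀ x ∈ B, f 0 x = 0 := by
  induction m generalizing F with
  | zero =>
    refine ⟨fun _ => F, rfl, fun i hi => ?_, fun i hi => absurd hi (Nat.not_lt_zero i), hFU⟩
    rw [Nat.le_zero.1 hi]
    exact hF
  | succ m ih =>
    have hU : B.infUpTo C m ≤ A m :=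
      Subgroup.infUpTo_le_of_chain hB fun i hi => hC' i (hi.trans (Nat.lt_succ_self m))
    -- Restrict `F` to `C m` and extend to `A m`. The extension must vanish on the intersection up
    -- to `m`, as the induction requires; its part inside `C m` is the intersection up to `m + 1`,
    -- where `F` is already zero.
    obtain ⟨F', hF', hF'C, hF'U⟩ := Subgroup.AdditiveOn.exists_extension (hC m (Nat.lt_succ_self m))
      hU (hA m (Nat.le_succ m)) (hF.mono (hC' m (Nat.lt_succ_self m)))
      (fun x hx hxU => hFU x ⟨hxU, hx⟩)
    obtain ⟨f, hfm, hfA, hfC, hfB⟩ := ih (fun i hi => hA i (by omega)) (fun i hi => hC i (by omega))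
      (fun i hi => hC' i (by omega)) F' hF' hF'U
    refine ⟨fun i => if i ≤ m then f i else F, ?_, fun i hi => ?_, fun i hi x hx => ?_, ?_⟩
    · simp
    · by_cases h : i ≤ m
      · simpa only [h, if_true] using hfA i h
      · have : i = m + 1 := by omega
        subst this
        simpa only [h, if_false] using hF
    · by_cases h : i < m
      · simpa only [h.le, Nat.succ_le_of_lt h, if_true] using hfC i h x hx
      · have : i = m := by omega
        subst this
        simp only [le_refl, if_true, hfm, hF'C x hx, Nat.not_succ_le_self, if_false]
    · simpa using hfB

/-- A nonzero finite family of additive rational functions on finitely generated groups is, up to a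
factor, integral with values that generate `ℤ`. -/
theorem exists_integral_family (A : ℕ → Subgroup G) (m : ℕ) (hfg : ∀ i ≤ m, (A i).FG)
    (f : ℕ → G → ℚ) (hf : ∀ i ≤ m, (A i).AdditiveOn (f i))
    (hne : ∃ i ≤ m, ∃ x ∈ A i, f i x ≠ 0) :
    ∃ (q : ℚ) (F : ℕ → G → ℤ), q ≠ 0 ∧ (∀ i ≤ m, ∀ x ∈ A i, f i x = F i x * q) ∧
      AddSubgroup.closure {n : ℤ | ∃ i ≤ m, ∃ x ∈ A i, F i x = n} = ⊤ := by
  classical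
  set S : Set ℚ := {y | ∃ i ≤ m, ∃ x ∈ A i, f i x = y} with hS
  have hSfg : (Submodule.span ℤ S).FG := by
    choose! X hX using hfg
    set Y : Finset ℚ := (Finset.range (m + 1)).biUnion fun i => (X i).image (f i) with hY
    refine ⟨Y, le_antisymm (Submodule.span_mono ?_) (Submodule.span_le.2 ?_)⟩
    · intro y hy
      simp only [hY, Finset.coe_biUnion, Set.mem_iUnion, Finset.coe_image, Finset.coe_range,
        Set.mem_Iio] at hy
      obtain ⟨i, hi, x, hx, rfl⟩ := hy
      refine ⟨i, by omega, x, ?_, rfl⟩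
      rw [← hX i (by omega)]
      exact Subgroup.subset_closure hx
    · rintro _ ⟨i, hi, x, hx, rfl⟩
      rw [SetLike.mem_coe]
      rw [← hX i hi] at hx
      have key : x ∈ A i ∧ f i x ∈ Submodule.span ℤ (Y : Set ℚ) := by
        induction hx using Subgroup.closure_induction with
        | mem x hxX =>
          refine ⟨hX i hi ▸ Subgroup.subset_closure hxX, Submodule.subset_span ?_⟩
          simp only [hY, Finset.coe_biUnion, Set.mem_iUnion, Finset.coe_image, Finset.coe_range,
            Set.mem_Iio]
          exact ⟨i, by omega, x, hxX, rfl⟩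
        | one => exact ⟨(A i).one_mem, (hf i hi).map_one ▸ Submodule.zero_mem _⟩
        | mul x y hx hy ihx ihy =>
          have hx1 : x ∈ A i := hX i hi ▸ hx
          have hy1 : y ∈ A i := hX i hi ▸ hy
          refine ⟨(A i).mul_mem hx1 hy1, ?_⟩
          rw [hf i hi x hx1 y hy1]
          exact Submodule.add_mem _ ihx.2 ihy.2
        | inv x hx ihx =>
          have hx1 : x ∈ A i := hX i hi ▸ hx
          refine ⟨(A i).inv_mem hx1, ?_⟩
          rw [(hf i hi).map_inv hx1]
          exact Submodule.neg_mem _ ihx.2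
      exact key.2
  -- The values span a finitely generated submodule of `ℚ`, a fractional ideal of the principal
  -- ideal domain `ℤ`; its generator `q` is the scaling factor.
  have hfrac : IsFractional (nonZeroDivisors ℤ) (Submodule.span ℤ S) :=
    FractionalIdeal.isFractional_of_fg hSfg
  have hprin : (Submodule.span ℤ S).IsPrincipal :=
    FractionalIdeal.isPrincipal (⟨Submodule.span ℤ S, hfrac⟩ : FractionalIdeal (nonZeroDivisors ℤ) ℚ)
  obtain ⟨q, hq⟩ := hprin
  have hmem : ∀ i x, ∃ n : ℤ, i ≤ m → x ∈ A i → f i x = n * q := by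
    intro i x
    by_cases h : i ≤ m ∧ x ∈ A i
    · have h1 : f i x ∈ Submodule.span ℤ S := Submodule.subset_span ⟨i, h.1, x, h.2, rfl⟩
      rw [hq, Submodule.mem_span_singleton] at h1
      obtain ⟨n, hn⟩ := h1
      exact ⟨n, fun _ _ => by rw [← hn, zsmul_eq_mul]⟩
    · exact ⟨0, fun h1 h2 => absurd ⟨h1, h2⟩ h⟩
  choose F hF using hmem
  have hq0 : q ≠ 0 := by
    obtain ⟨i, hi, x, hx, h⟩ := hne
    rintro rfl
    exact h (by rw [hF i x hi hx, mul_zero])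
  refine ⟨q, F, hq0, fun i hi x hx => hF i x hi hx, ?_⟩
  set K := AddSubgroup.closure {n : ℤ | ∃ i ≤ m, ∃ x ∈ A i, F i x = n} with hK
  have hqS : q ∈ Submodule.span ℤ S := by
    rw [hq]
    exact Submodule.mem_span_singleton_self q
  -- Applied to `q` itself, this puts `1` into `K`.
  have key : ∀ y ∈ Submodule.span ℤ S, ∃ n ∈ K, y = n * q := by
    intro y hy
    induction hy using Submodule.span_induction with
    | mem y hy =>
      obtain ⟨i, hi, x, hx, rfl⟩ := hy
      exact ⟨F i x, AddSubgroup.subset_closure ⟨i, hi, x, hx, rfl⟩, hF i x hi hx⟩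
    | zero => exact ⟨0, K.zero_mem, by simp⟩
    | add y z _ _ ihy ihz =>
      obtain ⟨n, hn, rfl⟩ := ihy
      obtain ⟨k, hk, rfl⟩ := ihz
      exact ⟨n + k, K.add_mem hn hk, by push_cast; ring⟩
    | smul a y _ ih =>
      obtain ⟨n, hn, rfl⟩ := ih
      refine ⟨a • n, K.zsmul_mem hn a, ?_⟩
      rw [zsmul_eq_mul, smul_eq_mul]
      push_cast
      ring
  obtain ⟨n, hn, hnq⟩ := key q hqS
  have h1 : (n : ℚ) = 1 := by
    apply mul_right_cancel₀ hq0
    rw [one_mul, ← hnq]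
  have h2 : n = 1 := by exact_mod_cast h1
  rw [h2] at hn
  rw [eq_top_iff]
  intro k _
  simpa using K.zsmul_mem hn k

end Subgroup

/-! ### Properties of free abelian groups of finite rank -/

namespace IsFreeAbelianOfFiniteRank

variable {G : Type*} [Group G] {A : Subgroup G}

theorem mul_comm (h : IsFreeAbelianOfFiniteRank A) : ∀ x ∈ A, ∀ y ∈ A, x * y = y * x := by
  obtain ⟨n, ⟨e⟩⟩ := h
  intro x hx y hy
  have h1 : (⟨x, hx⟩ * ⟨y, hy⟩ : A) = ⟨y, hy⟩ * ⟨x, hx⟩ := by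
    apply e.injective
    rw [map_mul, map_mul, _root_.mul_comm]
  exact congrArg Subtype.val h1

theorem eq_one_of_zpow (h : IsFreeAbelianOfFiniteRank A) :
    ∀ x ∈ A, ∀ n : ℤ, n ≠ 0 → x ^ n = 1 → x = 1 := by
  obtain ⟨k, ⟨e⟩⟩ := h
  intro x hx n hn hxn
  have h1 : (⟨x, hx⟩ : A) ^ n = 1 := Subtype.ext hxn
  have h2 : n • (e ⟨x, hx⟩).toAdd = 0 := by
    rw [← toAdd_zpow, ← map_zpow, h1, map_one, toAdd_one]
  have h3 : e ⟨x, hx⟩ = 1 := by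
    apply Multiplicative.toAdd.injective
    exact (smul_eq_zero.1 h2).resolve_left hn
  have h4 : (⟨x, hx⟩ : A) = 1 := by
    rw [← map_one e] at h3
    exact e.injective h3
  exact congrArg Subtype.val h4

theorem fg (h : IsFreeAbelianOfFiniteRank A) : A.FG := by
  obtain ⟨n, ⟨e⟩⟩ := h
  rw [← Group.fg_iff_subgroup_fg]
  have h1 : Group.FG (Multiplicative (Fin n → ℤ)) := by
    rw [← AddGroup.fg_iff_mul_fg, AddGroup.fg_iff_addMonoid_fg, ← Module.Finite.iff_addMonoid_fg]
    infer_instance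
  exact Group.fg_of_surjective (f := e.symm.toMonoidHom) e.symm.surjective

end IsFreeAbelianOfFiniteRank

/-! ### Generators of the group and maps onto the free group -/

namespace OrientedGraph

open MulAction (stabilizer mem_stabilizer_iff)

variable {V E : Type*} {T : OrientedGraph V E} {G : Type*} [Group G] [MulAction G V]
  [MulAction G E]

theorem IsAction.stabilizer_le (hG : T.IsAction G) {d : E} {x y : V} (h : T.ends d = s(x, y)) :
    stabilizer G d ≤ stabilizer G x ∧ stabilizer G d ≤ stabilizer G y := by
  have h1 : stabilizer G d ≤ stabilizer G (T.src d) := fun g hg => by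
    rw [mem_stabilizer_iff] at hg ⊢
    rw [← hG.src_smul, hg]
  have h2 : stabilizer G d ≤ stabilizer G (T.tgt d) := fun g hg => by
    rw [mem_stabilizer_iff] at hg ⊢
    rw [← hG.tgt_smul, hg]
  rcases Sym2.eq_iff.1 h with ⟨rfl, rfl⟩ | ⟨rfl, rfl⟩
  · exact ⟨h1, h2⟩
  · exact ⟨h2, h1⟩

theorem IsAction.ends_smul (hG : T.IsAction G) (g : G) {d : E} {x y : V}
    (h : T.ends d = s(x, y)) : T.ends (g • d) = s(g • x, g • y) := by
  rw [ends, hG.src_smul, hG.tgt_smul]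
  rcases Sym2.eq_iff.1 h with ⟨rfl, rfl⟩ | ⟨rfl, rfl⟩
  · rfl
  · exact Sym2.eq_swap

namespace CircuitLift

variable {a : E} (L : CircuitLift T G a)

theorem ends_smul_a (hG : T.IsAction G) : T.ends (L.t • a) = s(L.t • L.v L.m, L.v 0) := by
  rw [hG.ends_smul L.t L.ends_a, smul_inv_smul]

/-- The vertices of the path lie in distinct orbits, and a translation that reverses the edge would
give both `i + 1 = j` and `i = j + 1`. -/
theorem edge_inj (hG : T.IsAction G) {i j : ℕ} (hi : i < L.m) (hj : j < L.m) {g : G}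
    (h : g • L.e i = L.e j) : i = j := by
  have h1 := hG.ends_smul g (L.ends_e i hi)
  rw [h, L.ends_e j hj] at h1
  rcases Sym2.eq_iff.1 h1 with ⟨h2, -⟩ | ⟨h2, h3⟩
  · exact L.vertex_inj i hi.le j hj.le g h2.symm
  · have h4 := L.vertex_inj (i + 1) hi j hj.le g h2.symm
    have h5 := L.vertex_inj i hi.le (j + 1) hj g h3.symm
    omega

/-- The group is generated by the vertex stabilizers along the path and the closing element. -/
theorem eq_top (hT : T.IsTree) (hG : T.IsAction G) (M : Subgroup G)
    (hM : ∀ i ≤ L.m, stabilizer G (L.v i) ≤ M) (ht : L.t ∈ M) : M = ⊤ := by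
  -- `P (h • L.v i)` means `h ∈ M`, independently of `h` because `M` contains the stabilizers. It
  -- passes along translates of path edges with the same `h`, and along translates of `a` because
  -- `L.t ∈ M`.
  set P : V → Prop := fun w => ∀ g : G, ∀ i ≤ L.m, g • L.v i = w → g ∈ M with hP
  have hPiff : ∀ (h : G), ∀ i ≤ L.m, (P (h • L.v i) ↔ h ∈ M) := by
    intro h i hi
    refine ⟨fun h1 => h1 h i hi rfl, fun hh g j hj hgj => ?_⟩
    have h1 : (h⁻¹ * g) • L.v j = L.v i := by rw [mul_smul, hgj, inv_smul_smul]
    have h2 := L.vertex_inj j hj i hi _ h1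
    subst h2
    have h3 := M.mul_mem hh (hM j hj (mem_stabilizer_iff.2 h1))
    rwa [mul_inv_cancel_left] at h3
  have hends : ∀ {d : E} {x y : V}, T.ends d = s(x, y) → (P x ↔ P y) →
      (P (T.src d) ↔ P (T.tgt d)) := by
    intro d x y hd hxy
    rcases Sym2.eq_iff.1 hd with ⟨h1, h2⟩ | ⟨h1, h2⟩
    · rw [h1, h2]
      exact hxy
    · rw [h1, h2]
      exact hxy.symm
  have hall : ∀ w, P w := by
    refine hT.induction P (fun d => ?_) (v := L.v 0)
      (by simpa using (hPiff 1 0 (Nat.zero_le _)).2 M.one_mem)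
    rcases L.edge_cover d with ⟨h, rfl⟩ | ⟨i, hi, h, rfl⟩
    · refine hends (hG.ends_smul h L.ends_a) ?_
      rw [hPiff h L.m le_rfl, ← mul_smul, hPiff _ 0 (Nat.zero_le _),
        M.mul_mem_cancel_right (M.inv_mem ht)]
    · refine hends (hG.ends_smul h (L.ends_e i hi)) ?_
      rw [hPiff h i hi.le, hPiff h (i + 1) hi]
  rw [eq_top_iff]
  intro g _
  exact hall (g • L.v 0) g 0 (Nat.zero_le _) rfl

/-- Integral additive functions on the vertex stabilizers that agree on the edge stabilizers along
the path and vanish on the stabilizer of the closing edge, and whose values generate `ℤ`, define a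
surjection onto the free group of rank two. -/
theorem exists_surjective (hT : T.IsTree) (hG : T.IsAction G) (F : ℕ → G → ℤ)
    (hF : ∀ i ≤ L.m, (stabilizer G (L.v i)).AdditiveOn (F i))
    (hFe : ∀ i < L.m, ∀ x ∈ stabilizer G (L.e i), F i x = F (i + 1) x)
    (hFa : ∀ x ∈ stabilizer G a, F L.m x = 0)
    (hFb : ∀ x ∈ stabilizer G (L.t • a), F 0 x = 0)
    (hFtop : AddSubgroup.closure
      {n : ℤ | ∃ i ≤ L.m, ∃ x ∈ stabilizer G (L.v i), F i x = n} = ⊤) :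
    ∃ φ : G →* FreeGroup (Fin 2), Function.Surjective φ := by
  classical
  choose idx hidx ρ hρ using L.vertex_cover
  have hidx_smul : ∀ (g : G) w, idx (g • w) = idx w := by
    intro g w
    refine L.vertex_inj _ (hidx _) _ (hidx _) ((ρ w)⁻¹ * g⁻¹ * ρ (g • w)) ?_
    rw [mul_smul, hρ, mul_smul, inv_smul_smul, inv_smul_eq_iff, hρ]
  have hidx_v : ∀ i ≤ L.m, idx (L.v i) = i := fun i hi =>
    L.vertex_inj _ (hidx _) _ hi _ (hρ (L.v i))
  -- Each vertex is identified with its representative on the path through `ρ`, which turns the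
  -- functions `F i` into an integral cocycle on all vertices.
  set k : G → V → ℤ := fun g w => F (idx w) ((ρ (g • w))⁻¹ * g * ρ w) with hk
  have hmem : ∀ g w, (ρ (g • w))⁻¹ * g * ρ w ∈ stabilizer G (L.v (idx w)) := by
    intro g w
    rw [mem_stabilizer_iff, mul_smul, mul_smul, hρ, inv_smul_eq_iff]
    conv_rhs => rw [← hidx_smul g w, hρ]
  have hkmul : ∀ g h w, k (g * h) w = k g (h • w) + k h w := by
    intro g h w
    have h1 := hmem g (h • w)
    rw [hidx_smul] at h1
    simp only [hk, hidx_smul]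
    rw [← hF _ (hidx w) _ h1 _ (hmem h w)]
    congr 1
    rw [mul_smul]
    group
  -- `ρ (L.v i)` need not be `1`, but it lies in the stabilizer, and conjugation by it does not
  -- change `F i`.
  have hkv : ∀ i ≤ L.m, ∀ g ∈ stabilizer G (L.v i), k g (L.v i) = F i g := by
    intro i hi g hg
    have h1 : ρ (L.v i) ∈ stabilizer G (L.v i) := by
      have h2 := hρ (L.v i)
      rwa [hidx_v i hi] at h2
    simp only [hk, hidx_v i hi]
    rw [mem_stabilizer_iff.1 hg]
    exact (hF i hi).map_conj hg h1
  have hk1 : ∀ w, k 1 w = 0 := fun w => by simpa using hkmul 1 1 w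
  have hkb : ∀ g ∈ stabilizer G a, k g (L.t⁻¹ • L.v 0) = 0 := by
    intro g hg
    have h1 : L.t * g * L.t⁻¹ ∈ stabilizer G (L.t • a) := by
      rw [mem_stabilizer_iff, mul_smul, mul_smul, inv_smul_smul, mem_stabilizer_iff.1 hg]
    have h2 := (hG.stabilizer_le (L.ends_smul_a hG)).2 h1
    have h3 : g • L.t⁻¹ • L.v 0 = L.t⁻¹ • L.v 0 := (hG.stabilizer_le L.ends_a).2 hg
    have h4 := hkv 0 (Nat.zero_le _) _ h2
    -- The values at `L.t` and `L.t⁻¹` cancel, so `k g` at `L.t⁻¹ • L.v 0` is the value of `F 0` at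
    -- `L.t * g * L.t⁻¹`.
    have h5 := hkmul L.t L.t⁻¹ (L.v 0)
    rw [mul_inv_cancel, hk1] at h5
    rw [hFb _ h1, hkmul, hkmul, h3] at h4
    linarith
  set x : FreeGroup (Fin 2) := FreeGroup.of 0 with hx
  set y : FreeGroup (Fin 2) := FreeGroup.of 1 with hy
  -- Transport is trivial along the path and equals `y` from `L.v L.m` to `L.t⁻¹ • L.v 0`; the
  -- inverse occurs if `a` is oriented the other way.
  set τ₀ : E → FreeGroup (Fin 2) := fun d =>
    if d = a then (if T.src a = L.v L.m then y else y⁻¹) else 1 with hτ₀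
  have hτe : ∀ i < L.m, τ₀ (L.e i) = 1 := by
    intro i hi
    have : L.e i ≠ a := by simpa using L.edge_ne i hi 1
    simp only [hτ₀, this, if_false]
  obtain ⟨σ, φ, hσ0, hσ, hφ⟩ := hT.exists_monoidHom_of_cocycle hG (fun g w => x ^ k g w)
    (fun g h w => by rw [hkmul, zpow_add]) {d | d = a ∨ ∃ i < L.m, d = L.e i}
    (fun d => by
      rcases L.edge_cover d with ⟨g, hg⟩ | ⟨i, hi, g, hg⟩
      · exact ⟨a, Or.inl rfl, g, hg⟩
      · exact ⟨L.e i, Or.inr ⟨i, hi, rfl⟩, g, hg⟩)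
    (by
      rintro _ (rfl | ⟨i, hi, rfl⟩) _ (rfl | ⟨j, hj, rfl⟩) g hg
      · rfl
      · exact absurd (inv_smul_eq_iff.2 hg.symm) (L.edge_ne j hj g⁻¹)
      · exact absurd hg (L.edge_ne i hi g)
      · rw [L.edge_inj hG hi hj hg])
    τ₀
    (by
      have aux : ∀ (d : E) (s : G) (z w : V), T.ends d = s(z, w) → k s z = k s w →
          k s (T.tgt d) = k s (T.src d) := by
        intro d s z w hd hzw
        rcases Sym2.eq_iff.1 hd with ⟨h1, h2⟩ | ⟨h1, h2⟩
        · rw [h1, h2, hzw]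
        · rw [h1, h2, hzw]
      rintro d (hd | ⟨i, hi, rfl⟩) s hs
      · rw [hd] at hs ⊢
        have h1 : k s (L.v L.m) = 0 := by
          rw [hkv _ le_rfl s ((hG.stabilizer_le L.ends_a).1 hs), hFa s hs]
        have h2 := hkb s hs
        have h3 : k s (T.src a) = 0 ∧ k s (T.tgt a) = 0 := by
          rcases Sym2.eq_iff.1 L.ends_a with ⟨h3, h4⟩ | ⟨h3, h4⟩ <;> rw [h3, h4]
          · exact ⟨h1, h2⟩
          · exact ⟨h2, h1⟩
        simp only [h3.1, h3.2, zpow_zero, one_mul, mul_one]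
      · have h1 := hG.stabilizer_le (L.ends_e i hi)
        have h2 := aux _ s _ _ (L.ends_e i hi) (by
          rw [hkv i hi.le s (h1.1 hs), hkv (i + 1) hi s (h1.2 hs), hFe i hi s hs])
        simp only [hτe i hi, one_mul, mul_one, h2])
    (L.v 0)
  have hσv : ∀ i ≤ L.m, σ (L.v i) = 1 := by
    intro i
    induction i with
    | zero => exact fun _ => hσ0
    | succ i ih =>
      intro hi
      have h1 := hσ (L.e i) (Or.inr ⟨i, hi, rfl⟩)
      rw [hτe i hi, one_mul] at h1
      rcases Sym2.eq_iff.1 (L.ends_e i hi) with ⟨h2, h3⟩ | ⟨h2, h3⟩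
      · rw [← h3, h1, h2, ih (Nat.le_of_lt hi)]
      · rw [← h2, ← h1, h3, ih (Nat.le_of_lt hi)]
  have hσu : σ (L.t⁻¹ • L.v 0) = y := by
    have h1 := hσ a (Or.inl rfl)
    rcases Sym2.eq_iff.1 L.ends_a with ⟨h2, h3⟩ | ⟨h2, h3⟩
    · simp only [hτ₀, h2, if_true] at h1
      rw [← h3, h1, hσv _ le_rfl, mul_one]
    · have h4 : T.src a ≠ L.v L.m := fun h => hT.no_loops a (h.trans h3.symm)
      simp only [hτ₀, h4, if_true, if_false] at h1
      rw [h3, h2, hσv _ le_rfl] at h1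
      exact (inv_mul_eq_one.1 h1.symm).symm
  refine ⟨φ, ?_⟩
  rw [← MonoidHom.range_eq_top]
  have hxn : ∀ n : ℤ, x ^ n ∈ φ.range := by
    intro n
    have hn : n ∈ AddSubgroup.closure
      {n : ℤ | ∃ i ≤ L.m, ∃ x ∈ stabilizer G (L.v i), F i x = n} := hFtop ▸ AddSubgroup.mem_top n
    induction hn using AddSubgroup.closure_induction with
    | mem n hn =>
      obtain ⟨i, hi, g, hg, rfl⟩ := hn
      refine ⟨g, ?_⟩
      rw [hφ g (L.v i), mem_stabilizer_iff.1 hg, hσv i hi, hkv i hi g hg, inv_one, one_mul, mul_one]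
    | zero => exact φ.range.one_mem
    | add n l _ _ hn hl =>
      rw [zpow_add]
      exact φ.range.mul_mem hn hl
    | neg n _ hn =>
      rw [zpow_neg]
      exact φ.range.inv_mem hn
  -- `φ L.t` is a power of `x` times `y`, and the powers of `x` are already in the range.
  have hyr : y ∈ φ.range := by
    have h1 : φ L.t ∈ φ.range := ⟨L.t, rfl⟩
    rw [hφ L.t (L.t⁻¹ • L.v 0), smul_inv_smul, hσ0, inv_one, one_mul, hσu] at h1
    exact (φ.range.mul_mem_cancel_left (hxn _)).1 h1
  rw [eq_top_iff, ← FreeGroup.closure_range_of, Subgroup.closure_le]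
  rintro _ ⟨j, rfl⟩
  fin_cases j
  · simpa using hxn 1
  · exact hyr

/-- If the stabilizer of the closing edge is a proper direct factor of the stabilizer of the last
vertex of the path, then the group maps onto the free group of rank two. -/
theorem exists_surjective_of_ne (hT : T.IsTree) (hG : T.IsAction G)
    (hvertex : ∀ v : V, IsFreeAbelianOfFiniteRank (stabilizer G v))
    (hconj : ∀ x y z : G, x * y = y * x → z * x * z⁻¹ = y → x = y)
    (hfactor : (stabilizer G a).IsDirectFactorOf (stabilizer G (L.v L.m)))
    (hne : stabilizer G a ≠ stabilizer G (L.v L.m)) :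
    ∃ φ : G →* FreeGroup (Fin 2), Function.Surjective φ := by
  obtain ⟨f, hf, hfa, x, hx, hfx⟩ := Subgroup.AdditiveOn.exists_ne_zero
    (hvertex (L.v L.m)).mul_comm (hvertex (L.v L.m)).eq_one_of_zpow hfactor hne
  have hB := (hG.stabilizer_le (L.ends_smul_a hG)).2
  have hC := fun (i : ℕ) (hi : i < L.m) => (hG.stabilizer_le (L.ends_e i hi)).1
  have hC' := fun (i : ℕ) (hi : i < L.m) => (hG.stabilizer_le (L.ends_e i hi)).2
  -- elements that fix the path and both adjacent translates of `a` commute with the closing element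
  have hU : (stabilizer G (L.t • a)).infUpTo (fun i => stabilizer G (L.e i)) L.m ≤
      stabilizer G a := by
    intro g hg
    have h1 := Subgroup.infUpTo_le _ _ _ hg
    have h2 : g ∈ stabilizer G (L.v L.m) :=
      Subgroup.infUpTo_le_of_chain (A := fun i => stabilizer G (L.v i)) hB hC' hg
    have h3 : L.t⁻¹ * g * L.t ∈ stabilizer G a := by
      rw [mem_stabilizer_iff] at h1 ⊢
      rw [mul_smul, mul_smul, h1, inv_smul_smul]
    -- Both conjugates lie in the abelian stabilizer of `L.v L.m`, so they commute and hence
    -- coincide.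
    have h4 := hconj g (L.t⁻¹ * g * L.t) L.t⁻¹
      ((hvertex (L.v L.m)).mul_comm _ h2 _ ((hG.stabilizer_le L.ends_a).1 h3)) (by rw [inv_inv])
    rwa [← h4] at h3
  obtain ⟨fam, hfm, hfA, hfC, hfB⟩ := Subgroup.exists_compatible_family
    (fun i => stabilizer G (L.v i)) (fun i => stabilizer G (L.e i)) (stabilizer G (L.t • a)) hB L.m
    (fun i _ => (hvertex (L.v i)).mul_comm) hC hC' f hf (fun g hg => hfa g (hU hg))
  obtain ⟨q, F, hq, hFq, htop⟩ := Subgroup.exists_integral_family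
    (fun i => stabilizer G (L.v i)) L.m (fun i _ => (hvertex (L.v i)).fg) fam hfA
    ⟨L.m, le_rfl, x, hx, by rwa [hfm]⟩
  have hcancel : ∀ {n l : ℤ}, (n : ℚ) * q = l * q → n = l := fun h => by
    exact_mod_cast mul_right_cancel₀ hq h
  refine L.exists_surjective hT hG F (fun i hi g hg h hh => ?_) (fun i hi g hg => ?_)
    (fun g hg => ?_) (fun g hg => ?_) htop
  · apply hcancel
    rw [← hFq i hi _ (Subgroup.mul_mem _ hg hh), hfA i hi g hg h hh, hFq i hi g hg, hFq i hi h hh]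
    push_cast
    ring
  · apply hcancel
    rw [← hFq i hi.le g (hC i hi hg), hfC i hi g hg, hFq (i + 1) hi g (hC' i hi hg)]
  · apply hcancel
    rw [← hFq L.m le_rfl g ((hG.stabilizer_le L.ends_a).1 hg), hfm, hfa g hg]
    simp
  · apply hcancel
    rw [← hFq 0 (Nat.zero_le _) g (hB hg), hfB g hg]
    simp

end CircuitLift

end OrientedGraph

/-! ### The case distinction on edge stabilizers -/

theorem mainTheorem7 {G V E : Type*} [Group G] [MulAction G V] [MulAction G E]
    (T : OrientedGraph V E) (hT : T.IsTree) (hG : T.IsAction G)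
    (hsol : ¬ Group.IsSolvable G)
    (hcircle : Nonempty ((T.quotient G hG).Realization ≃ₜ Circle))
    (hvertex : ∀ v : V, IsFreeAbelianOfFiniteRank (MulAction.stabilizer G v))
    (hedge : ∀ e : E,
      (MulAction.stabilizer G e).IsDirectFactorOf (MulAction.stabilizer G (T.src e)) ∧
      (MulAction.stabilizer G e).IsDirectFactorOf (MulAction.stabilizer G (T.tgt e)))
    (hconj : ∀ x y z : G, x * y = y * x → z * x * z⁻¹ = y → x = y) :
    ∃ φ : G →* FreeGroup (Fin 2), Function.Surjective φ := by
  obtain ⟨hc⟩ := hcircle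
  by_cases hs : ∃ a, MulAction.stabilizer G a ≠ MulAction.stabilizer G (T.src a)
  · obtain ⟨a, ha⟩ := hs
    obtain ⟨L, hL⟩ := OrientedGraph.exists_circuitLift hT hG hc a (T.src a) (T.tgt a) rfl
    exact L.exists_surjective_of_ne hT hG hvertex hconj (hL ▸ (hedge a).1) (hL ▸ ha)
  by_cases ht : ∃ a, MulAction.stabilizer G a ≠ MulAction.stabilizer G (T.tgt a)
  · obtain ⟨a, ha⟩ := ht
    obtain ⟨L, hL⟩ := OrientedGraph.exists_circuitLift hT hG hc a (T.tgt a) (T.src a) Sym2.eq_swap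
    exact L.exists_surjective_of_ne hT hG hvertex hconj (hL ▸ (hedge a).2) (hL ▸ ha)
  -- Now every edge stabilizer equals the stabilizers of both end points.
  push Not at hs ht
  exfalso
  apply hsol
  obtain ⟨e⟩ : Nonempty (MulAction.orbitRel.Quotient G E) := by
    refine (T.quotient G hG).nonempty_edge_of_circle hc fun hE => ⟨fun x y => ?_⟩
    exact hT.quotient_induction hG (fun y => x = y) (fun e => hE.elim e) rfl y
  obtain ⟨a, rfl⟩ := Quotient.exists_rep e
  obtain ⟨L, -⟩ := OrientedGraph.exists_circuitLift hT hG hc a (T.src a) (T.tgt a) rfl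
  have hstab : ∀ w, MulAction.stabilizer G w = MulAction.stabilizer G (L.v 0) :=
    hT.induction (fun w => MulAction.stabilizer G w = MulAction.stabilizer G (L.v 0))
      (fun e => by rw [← hs, ht]) rfl
  -- The common stabilizer is normal and abelian, so each of its elements commutes with its
  -- conjugates and is therefore equal to them.
  have hcenter : ∀ w : V, MulAction.stabilizer G w ≤ Subgroup.center G := by
    intro w x hx
    rw [Subgroup.mem_center_iff]
    intro g
    have h1 : g * x * g⁻¹ ∈ MulAction.stabilizer G w := by
      rw [hstab w, ← hstab (g • w), MulAction.mem_stabilizer_iff, mul_smul, mul_smul, inv_smul_smul,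
        MulAction.mem_stabilizer_iff.1 hx]
    have h2 := hconj x _ g ((hvertex w).mul_comm x hx _ h1) rfl
    exact (eq_mul_inv_iff_mul_eq.1 h2).symm
  -- The centralizer of `L.t` contains the central stabilizers and `L.t` itself, which generate `G`.
  have htc : L.t ∈ Subgroup.center G := by
    have h1 := L.eq_top hT hG (Subgroup.centralizer {L.t})
      (fun i _ => (hcenter _).trans (Subgroup.center_le_centralizer _))
      (Subgroup.mem_centralizer_singleton_iff.2 rfl)
    rw [Subgroup.mem_center_iff]
    intro g
    have h2 : g ∈ Subgroup.centralizer {L.t} := h1 ▸ Subgroup.mem_top g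
    exact Subgroup.mem_centralizer_singleton_iff.1 h2
  have htop := L.eq_top hT hG (Subgroup.center G) (fun i _ => hcenter _) htc
  refine Group.isSolvable_of_comm fun g h => ?_
  have h1 : h ∈ Subgroup.center G := htop ▸ Subgroup.mem_top h
  exact Subgroup.mem_center_iff.1 h1 g
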